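/- Let $\mathcal M$ be a model of (first-order) Peano Arithmetic, viewed as an ordered commutative ring whose non-negative part satisfies PA. Let $p\in\mathcal M$ be a prime, $p>0$, and let $k\in\mathcal M$, $k>0$ ($p$ and $k$ may be standard or nonstandard). Let $p^k\in\mathcal M$ be the (existing) value of the exponential function of $\mathcal M$, as defined arithmetically through G\"odel's coding of sequences. Then $\mathcal M/p^k\mathcal M$ is a local ring, and there is a commutative ring $R$ such that: 1. $R$ is a Henselian valuation domain of characteristic $0$ which is unramified (that is, if the residue field of $R$ has prime characteristic $\ell$, then $v(\ell)$ is the least positive element of the value group). The value group $\Gamma$ of $R$ is a $\mathbb Z$-group (a model of Presburger arithmetic, i.e. an ordered abelian group with a least positive element $1_\Gamma$ such that for all integers $n\ge 1$ every $x\in\Gamma$ is of the form $ny+r1_\Gamma$ with $y\in\Gamma$, $0\le r<n$). Further, $\Gamma$ has $[0,k]$ as an initial segment of its non-negative part: there are $\gamma\in\Gamma$, $\gamma>0$, and an order isomorphism $[0,k]_{\mathcal M}\cong[0,\gamma]_\Gamma$ that respects those sums which stay in the segment. 2. $\mathcal M/p^k\mathcal M$ is isomorphic to $R/I$ for a principal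 ideal $I$ of $R$, namely $I=\alpha R$ for some $\alpha\ne 0$ with $v(\alpha)=\gamma$. 3. The residue field of $R$ is naturally isomorphic to the residue field of $\mathcal M/p^k\mathcal M$, that is, by an isomorphism compatible with $R\to R/I\cong\mathcal M/p^k\mathcal M$. -/

import Mathlib

open FirstOrder Language

universe u

/-! ### Peano Arithmetic -/

/-- The function symbols `0, 1, +, ·` of the language of arithmetic. -/
inductive ArithFunc : ℕ → Type
  | zero : ArithFunc 0
  | one : ArithFunc 0
  | add : ArithFunc 2
  | mul : ArithFunc 2

/-- The first-order language of arithmetic. (The order is definable: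
`x ≤ y` if and only if `x + z = y` for some `z`.) -/
def arith : Language where
  Functions := ArithFunc
  Relations := fun _ => Empty

namespace arith

/-- The constant term `0`. -/
def tZero {α : Type} : arith.Term α := Constants.term (L := arith) ArithFunc.zero

/-- The constant term `1`. -/
def tOne {α : Type} : arith.Term α := Constants.term (L := arith) ArithFunc.one

/-- The term `s + t`. -/
def tAdd {α : Type} (s t : arith.Term α) : arith.Term α :=
  Functions.apply₂ (L := arith) ArithFunc.add s t

/-- The term `s · t`. -/
def tMul {α : Type} (s t : arith.Term α) : arith.Term α :=
  Functions.apply₂ (L := arith) ArithFunc.mul s t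

/-- The tautological interpretation of the symbols `0, 1, +, ·`. -/
instance instStructure {M : Type*} [Zero M] [One M] [Add M] [Mul M] : arith.Structure M where
  funMap := fun {_} f =>
    match f with
    | ArithFunc.zero => fun _ => 0
    | ArithFunc.one => fun _ => 1
    | ArithFunc.add => fun v => v 0 + v 1
    | ArithFunc.mul => fun v => v 0 * v 1
  RelMap := fun {_} r => nomatch r

/-- `∀ x, x + 1 ≠ 0` -/
def axSuccNeZero : arith.Sentence :=
  ∀' ∼(tAdd (&0) tOne =' tZero)

/-- `∀ x y, x + 1 = y + 1 → x = y` -/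
def axSuccInj : arith.Sentence :=
  ∀' ∀' ((tAdd (&0) tOne =' tAdd (&1) tOne) ⟹ (&0 =' &1))

/-- `∀ x, x + 0 = x` -/
def axAddZero : arith.Sentence :=
  ∀' (tAdd (&0) tZero =' &0)

/-- `∀ x y, x + (y + 1) = (x + y) + 1` -/
def axAddSucc : arith.Sentence :=
  ∀' ∀' (tAdd (&0) (tAdd (&1) tOne) =' tAdd (tAdd (&0) (&1)) tOne)

/-- `∀ x, x · 0 = 0` -/
def axMulZero : arith.Sentence :=
  ∀' (tMul (&0) tZero =' tZero)

/-- `∀ x y, x · (y + 1) = x · y + x` -/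
def axMulSucc : arith.Sentence :=
  ∀' ∀' (tMul (&0) (tAdd (&1) tOne) =' tAdd (tMul (&0) (&1)) (&0))

/-- The instance of the induction scheme for the formula `φ(a₁, …, aₙ, x)`, where the induction
variable `x` is the one indexed by `Fin 1`:
`∀ a₁ … aₙ, φ(a, 0) → (∀ x, φ(a, x) → φ(a, x + 1)) → ∀ x, φ(a, x)`. -/
noncomputable def induction (n : ℕ) (φ : arith.Formula (Fin n ⊕ Fin 1)) : arith.Sentence :=
  let base : arith.Formula (Fin n) :=
    φ.subst (Sum.elim (fun i => Term.var i) (fun _ => tZero))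
  let step : arith.Formula (Fin n) :=
    Formula.iAlls (Fin 1) (φ.imp
      (φ.subst (Sum.elim (fun i => Term.var (Sum.inl i))
        (fun j => tAdd (Term.var (Sum.inr j)) tOne))))
  let concl : arith.Formula (Fin n) := Formula.iAlls (Fin 1) φ
  Formula.iAlls (Fin n) ((base.imp (step.imp concl)).relabel Sum.inr)

/-- First-order Peano Arithmetic `PA`. -/
def peano : arith.Theory :=
  {axSuccNeZero, axSuccInj, axAddZero, axAddSucc, axMulZero, axMulSucc} ∪
    {σ | ∃ (n : ℕ) (φ : arith.Formula (Fin n ⊕ Fin 1)), σ = induction n φ}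

end arith

/-- An ordered commutative ring `M` is (the ring of integers of) a model of Peano Arithmetic if its
non-negative part, with the operations of `M`, is a model of `PA`. -/
def IsPeanoRing (M : Type u) [CommRing M] [LinearOrder M] [IsStrictOrderedRing M] : Prop :=
  {x : M // 0 ≤ x} ⊨ arith.peano

/-! ### Exponentiation in a model of Peano Arithmetic -/

/-- `r` is the remainder of `a` on division by `m`. -/
def IsRem {M : Type u} [CommRing M] [LinearOrder M] (a m r : M) : Prop :=
  0 ≤ r ∧ r < m ∧ m ∣ a - r

/-- The graph of Gödel's beta function: `r = β(a, b, i)`, the remainder of `a` on division by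
`1 + (i + 1) b`. -/
def IsBeta {M : Type u} [CommRing M] [LinearOrder M] (a b i r : M) : Prop :=
  IsRem a (1 + (i + 1) * b) r

/-- The graph of the exponential function of a model of Peano Arithmetic, given by its usual
arithmetical definition: `q = p ^ k` if there is a (code of a) sequence `s₀, …, s_k` with `s₀ = 1`,
`s_{i + 1} = p s_i` for `i < k`, and `s_k = q`. Here `k` may be nonstandard. -/
def IsPow {M : Type u} [CommRing M] [LinearOrder M] (p k q : M) : Prop :=
  ∃ a b : M, 0 ≤ a ∧ 0 ≤ b ∧ IsBeta a b 0 1 ∧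
    (∀ i : M, 0 ≤ i → i < k → ∃ r : M, IsBeta a b i r ∧ IsBeta a b (i + 1) (p * r)) ∧
    IsBeta a b k q

/-! ### Valuation domains and ℤ-groups -/

/-- A `ℤ`-group (model of Presburger arithmetic): an ordered abelian group with a least positive
element `e` such that for all `n ≥ 1` every element is of the form `n y + r e` with `0 ≤ r < n`. -/
def IsPresburgerGroup (Γ : Type u) [AddCommGroup Γ] [LinearOrder Γ] [IsOrderedAddMonoid Γ] : Prop :=
  ∃ e : Γ, IsLeast {x : Γ | 0 < x} e ∧
    ∀ n : ℕ, 0 < n → ∀ x : Γ, ∃ (y : Γ) (r : ℕ), r < n ∧ x = n • y + r • e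

/-- The value group `K^×/R^×` of a valuation domain `R` with fraction field `K`, written additively
and ordered so that the elements of `R` have value `≥ 0`. (Mathlib's `ValuationRing.ValueGroup` is
multiplicative, contains the value of `0`, and has the values of elements of `R` at most `1`, whence
the units, `Additive` and the order dual.) -/
abbrev AddValueGroup (R : Type u) [CommRing R] [IsDomain R] [ValuationRing R] : Type u :=
  (Additive (ValuationRing.ValueGroup R (FractionRing R))ˣ)ᵒᵈ

/-- The additive value `v(x)` of a nonzero element `x` of a valuation domain. -/
noncomputable def addVal {R : Type u} [CommRing R] [IsDomain R] [ValuationRing R]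
    (x : R) (hx : x ≠ 0) : AddValueGroup R :=
  OrderDual.toDual (Additive.ofMul (Units.mk0
    (ValuationRing.valuation R (FractionRing R) (algebraMap R (FractionRing R) x))
    ((Valuation.ne_zero_iff _).2
      ((map_ne_zero_iff _ (IsFractionRing.injective R (FractionRing R))).2 hx))))

/-- A valuation domain of characteristic zero is unramified if either its residue field has
characteristic zero, or its residue field has characteristic a prime `ℓ` and `v(ℓ)` is the least
positive element of the value group. -/
def IsUnramifiedValuation (R : Type u) [CommRing R] [IsDomain R] [ValuationRing R] : Prop :=
  ∀ ℓ : ℕ, ℓ.Prime → (ℓ : R) ∈ IsLocalRing.maximalIdeal R →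
    ∃ h : (ℓ : R) ≠ 0, IsLeast {γ : AddValueGroup R | 0 < γ} (addVal (ℓ : R) h)

/-- The segments `[0, k]` and `[0, γ]` of two ordered abelian groups are isomorphic as ordered
partial (equivalently, truncated) additive structures. -/
def SegmentIso {M : Type u} [AddCommGroup M] [LinearOrder M] {Γ : Type u} [AddCommGroup Γ]
    [LinearOrder Γ] (k : M) (γ : Γ) : Prop :=
  ∃ f : Set.Icc (0 : M) k ≃o Set.Icc (0 : Γ) γ,
    ∀ x y z : Set.Icc (0 : M) k, (x : M) + y = z → (f x : Γ) + f y = f z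

/-! The ring `R` is the inverse limit of the rings `M / p^n` over all non-negative `n` in `M`,
nonstandard ones included. Everything elementary about powers of `p` holds in `M` by PA induction:
each nonzero `x` is `p^n u` with `p ∤ u`, such a `u` is invertible modulo every power of `p`, and a
simple root modulo `p` lifts modulo every `p^n`. These facts form `IsPowerSystem`; the algebra of
the limit uses nothing else.

The index set may have any cofinality, so compatible families cannot be built by recursion. Instead,
each element needed (a quotient by a power of `p`, an inverse, a Hensel root) is characterised at
level `n` by a condition with a unique solution modulo `p^n`; uniqueness makes arbitrary choices
compatible (`exists_of_unique`). It follows that a nonzero element of `R` is `p^n` times a unit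
(`exists_eq_mul_unit`), so the non-negative values form a copy of the non-negative part of `M`. This
gives the segment isomorphism, and the `ℤ`-group property by division with remainder in `M`. The
kernel of `R → M / p^k` is generated by `p^k`.

The base is formal: induction in PA applies only to definable predicates, and the exponential must
be shown total and functional from beta coding (`exists_beta_extension`). -/

/-- The non-negative part of an ordered ring. -/
abbrev NonnegPart (M : Type u) [CommRing M] [LinearOrder M] [IsStrictOrderedRing M] : Type u :=
  {x : M // 0 ≤ x}

/-! ### Definability by formulas with parameters, and induction. -/

section Arithmetical

variable {M : Type u} [CommRing M] [LinearOrder M] [IsStrictOrderedRing M] {α β : Type}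

/-- Functions on tuples of non-negative elements given by polynomials with coefficients in the
ring, that is, by differences of terms with parameters. -/
def IsPolynomialFun (F : (α → NonnegPart M) → M) : Prop :=
  ∃ S T : arith.Term (NonnegPart M ⊕ α), ∀ v,
    F v = (S.realize (Sum.elim id v) : NonnegPart M) - (T.realize (Sum.elim id v) : NonnegPart M)

/-- Predicates on tuples of non-negative elements defined by an arithmetical formula with
parameters. -/
def IsArithmetical (P : (α → NonnegPart M) → Prop) : Prop :=
  ∃ φ : arith.Formula (NonnegPart M ⊕ α), ∀ v, φ.Realize (Sum.elim id v) ↔ P v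

namespace arith

/-- The sum of two terms, with variables in an arbitrary universe. -/
def addTerm {γ : Type u} (s t : arith.Term γ) : arith.Term γ :=
  Functions.apply₂ (L := arith) ArithFunc.add s t

/-- The product of two terms, with variables in an arbitrary universe. -/
def mulTerm {γ : Type u} (s t : arith.Term γ) : arith.Term γ :=
  Functions.apply₂ (L := arith) ArithFunc.mul s t

theorem realize_addTerm {γ : Type u} (s t : arith.Term γ) (v : γ → NonnegPart M) :
    (addTerm s t).realize v = s.realize v + t.realize v :=
  Term.realize_functions_apply₂ (L := arith)

theorem realize_mulTerm {γ : Type u} (s t : arith.Term γ) (v : γ → NonnegPart M) :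
    (mulTerm s t).realize v = s.realize v * t.realize v :=
  Term.realize_functions_apply₂ (L := arith)

theorem realize_tAdd {γ : Type} (s t : arith.Term γ) (v : γ → NonnegPart M) :
    (tAdd s t).realize v = s.realize v + t.realize v :=
  Term.realize_functions_apply₂ (L := arith)

theorem realize_tOne {γ : Type} (v : γ → NonnegPart M) :
    (tOne : arith.Term γ).realize v = 1 :=
  Term.realize_constants (L := arith)

theorem realize_tZero {γ : Type} (v : γ → NonnegPart M) :
    (tZero : arith.Term γ).realize v = 0 :=
  Term.realize_constants (L := arith)

end arith

namespace IsPolynomialFun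

open arith

theorem var (a : α) : IsPolynomialFun fun v : α → NonnegPart M => (v a : M) :=
  ⟨Term.var (Sum.inr a), Term.var (Sum.inl 0), fun v => by simp⟩

theorem const (c : M) : IsPolynomialFun fun _ : α → NonnegPart M => c := by
  refine ⟨Term.var (Sum.inl ⟨max c 0, le_max_right _ _⟩),
    Term.var (Sum.inl ⟨max (-c) 0, le_max_right _ _⟩), fun v => ?_⟩
  rcases le_total c 0 with h | h <;> simp [h]

variable {F G : (α → NonnegPart M) → M}

theorem add (hF : IsPolynomialFun F) (hG : IsPolynomialFun G) :
    IsPolynomialFun fun v => F v + G v := by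
  obtain ⟨S, T, h⟩ := hF
  obtain ⟨S', T', h'⟩ := hG
  refine ⟨addTerm S S', addTerm T T', fun v => ?_⟩
  simp only [realize_addTerm, h, h', Nonneg.coe_add]
  ring

theorem neg (hF : IsPolynomialFun F) : IsPolynomialFun fun v => -F v := by
  obtain ⟨S, T, h⟩ := hF
  exact ⟨T, S, fun v => by simp [h]⟩

theorem sub (hF : IsPolynomialFun F) (hG : IsPolynomialFun G) :
    IsPolynomialFun fun v => F v - G v := by
  simpa only [sub_eq_add_neg] using hF.add hG.neg

theorem mul (hF : IsPolynomialFun F) (hG : IsPolynomialFun G) :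
    IsPolynomialFun fun v => F v * G v := by
  obtain ⟨S, T, h⟩ := hF
  obtain ⟨S', T', h'⟩ := hG
  refine ⟨addTerm (mulTerm S S') (mulTerm T T'), addTerm (mulTerm S T') (mulTerm T S'),
    fun v => ?_⟩
  simp only [realize_addTerm, realize_mulTerm, h, h', Nonneg.coe_add, Nonneg.coe_mul]
  ring

theorem comp (hF : IsPolynomialFun F) (σ : α → β) :
    IsPolynomialFun fun w : β → NonnegPart M => F fun a => w (σ a) := by
  obtain ⟨S, T, h⟩ := hF
  refine ⟨S.relabel (Sum.map id σ), T.relabel (Sum.map id σ), fun v => ?_⟩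
  simp only [Term.realize_relabel, Sum.elim_comp_map, h]
  rfl

theorem eval (f : Polynomial M) (hF : IsPolynomialFun F) :
    IsPolynomialFun fun v => f.eval (F v) := by
  induction f using Polynomial.induction_on' with
  | add f g hf hg => simpa only [Polynomial.eval_add] using hf.add hg
  | monomial n a =>
    simp only [Polynomial.eval_monomial]
    refine (const a).mul ?_
    induction n with
    | zero => simpa only [pow_zero] using const 1
    | succ n ih => simpa only [pow_succ] using ih.mul hF

end IsPolynomialFun

namespace IsArithmetical

open arith

variable {F G : (α → NonnegPart M) → M} {P Q : (α → NonnegPart M) → Prop}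

theorem eq (hF : IsPolynomialFun F) (hG : IsPolynomialFun G) :
    IsArithmetical fun v => F v = G v := by
  obtain ⟨S, T, h⟩ := hF
  obtain ⟨S', T', h'⟩ := hG
  refine ⟨(addTerm S T').equal (addTerm S' T), fun v => ?_⟩
  simp only [Formula.realize_equal, realize_addTerm, h, h', ← Subtype.coe_inj, Nonneg.coe_add]
  exact ⟨fun e => by linear_combination e, fun e => by linear_combination e⟩

theorem not (hP : IsArithmetical P) : IsArithmetical fun v => ¬ P v := by
  obtain ⟨φ, h⟩ := hP
  exact ⟨∼φ, fun v => by simp [Formula.realize_not, h]⟩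

theorem imp (hP : IsArithmetical P) (hQ : IsArithmetical Q) :
    IsArithmetical fun v => P v → Q v := by
  obtain ⟨φ, h⟩ := hP
  obtain ⟨ψ, h'⟩ := hQ
  exact ⟨φ.imp ψ, fun v => by simp [Formula.realize_imp, h, h']⟩

theorem congr (hP : IsArithmetical P) (h : ∀ v, Q v ↔ P v) : IsArithmetical Q := by
  obtain ⟨φ, h'⟩ := hP
  exact ⟨φ, fun v => by rw [h, h']⟩

theorem and (hP : IsArithmetical P) (hQ : IsArithmetical Q) :
    IsArithmetical fun v => P v ∧ Q v :=
  (hP.imp hQ.not).not.congr fun v => by tauto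

theorem or (hP : IsArithmetical P) (hQ : IsArithmetical Q) :
    IsArithmetical fun v => P v ∨ Q v :=
  (hP.not.imp hQ).congr fun v => by tauto

theorem comp (hP : IsArithmetical P) (σ : α → β) :
    IsArithmetical fun w : β → NonnegPart M => P fun a => w (σ a) := by
  obtain ⟨φ, h⟩ := hP
  refine ⟨φ.relabel (Sum.map id σ), fun v => ?_⟩
  rw [Formula.realize_relabel, Sum.elim_comp_map]
  exact h _

theorem exists_tuple [Finite β] {P : (α → NonnegPart M) → (β → NonnegPart M) → Prop}
    (h : IsArithmetical fun w : α ⊕ β → NonnegPart M =>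
      P (fun a => w (Sum.inl a)) fun b => w (Sum.inr b)) :
    IsArithmetical fun v => ∃ x, P v x := by
  obtain ⟨φ, h⟩ := h
  refine ⟨(φ.relabel (Equiv.sumAssoc (NonnegPart M) α β).symm).iExs β, fun v => ?_⟩
  rw [Formula.realize_iExs]
  refine exists_congr fun x => ?_
  rw [Formula.realize_relabel]
  refine Iff.trans (Eq.to_iff ?_) (h (Sum.elim v x))
  congr 1
  ext (a | a | a) <;> rfl

/-- Formulas quantify over non-negative elements only; a quantifier over `M` becomes one over pairs,
each element of `M` being a difference of two non-negative ones. -/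
theorem ex {P : (α → NonnegPart M) → M → Prop}
    (h : IsArithmetical fun w : α ⊕ Fin 2 → NonnegPart M =>
      P (fun a => w (Sum.inl a)) (w (Sum.inr 0) - w (Sum.inr 1))) :
    IsArithmetical fun v => ∃ x : M, P v x := by
  refine (exists_tuple (β := Fin 2) (P := fun v x => P v (x 0 - x 1)) h).congr fun v =>
    ⟨fun ⟨x, hx⟩ => ⟨![⟨max x 0, le_max_right _ _⟩, ⟨max (-x) 0, le_max_right _ _⟩], ?_⟩,
      fun ⟨x, hx⟩ => ⟨_, hx⟩⟩
  convert hx using 1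
  rcases le_total x 0 with h | h <;> simp [h]

theorem all {P : (α → NonnegPart M) → M → Prop}
    (h : IsArithmetical fun w : α ⊕ Fin 2 → NonnegPart M =>
      P (fun a => w (Sum.inl a)) (w (Sum.inr 0) - w (Sum.inr 1))) :
    IsArithmetical fun v => ∀ x : M, P v x :=
  (ex (P := fun v x => ¬ P v x) h.not).not.congr fun v => by push Not; rfl

theorem le (hF : IsPolynomialFun F) (hG : IsPolynomialFun G) :
    IsArithmetical fun v => F v ≤ G v := by
  refine (exists_tuple (β := Unit) (P := fun v x => F v + x () = G v)
    (eq ((hF.comp _).add (.var _)) (hG.comp _))).congr fun v =>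
    ⟨fun h => ⟨fun _ => ⟨G v - F v, sub_nonneg.2 h⟩, by simp⟩, fun ⟨x, hx⟩ => ?_⟩
  rw [← hx]
  exact le_add_of_nonneg_right (x ()).2

theorem lt (hF : IsPolynomialFun F) (hG : IsPolynomialFun G) :
    IsArithmetical fun v => F v < G v :=
  (le hG hF).not.congr fun _ => not_le.symm

theorem dvd (hF : IsPolynomialFun F) (hG : IsPolynomialFun G) :
    IsArithmetical fun v => F v ∣ G v :=
  ex (P := fun v x => G v = F v * x) (eq (hG.comp _) ((hF.comp _).mul ((var _).sub (var _))))
  where var {β : Type} (b : β) := IsPolynomialFun.var (M := M) b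

theorem isCoprime (hF : IsPolynomialFun F) (hG : IsPolynomialFun G) :
    IsArithmetical fun v => IsCoprime (F v) (G v) :=
  have hv {β : Type} (b c : β) := (IsPolynomialFun.var (M := M) b).sub (.var c)
  .ex <| .ex <| .eq (.add (.mul (hv _ _) (hF.comp _)) (.mul (hv _ _) (hG.comp _))) (.const 1)

variable {A B I R : (α → NonnegPart M) → M}

theorem isBeta (hA : IsPolynomialFun A) (hB : IsPolynomialFun B) (hI : IsPolynomialFun I)
    (hR : IsPolynomialFun R) : IsArithmetical fun v => IsBeta (A v) (B v) (I v) (R v) :=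
  have h := (IsPolynomialFun.const 1).add ((hI.add (.const 1)).mul hB)
  (le (.const 0) hR).and ((lt hR h).and (dvd h (hA.sub hR)))

theorem isPow (hA : IsPolynomialFun A) (hB : IsPolynomialFun B) (hR : IsPolynomialFun R) :
    IsArithmetical fun v => IsPow (A v) (B v) (R v) := by
  have hv {β : Type} (b : β) := IsPolynomialFun.var (M := M) b
  have hc {β : Type} (b : M) := IsPolynomialFun.const (M := M) (α := β) b
  refine ex <| ex <| and (le (hc _) ((hv _).sub (hv _))) <| and (le (hc _) ((hv _).sub (hv _))) <|
    and (isBeta ((hv _).sub (hv _)) ((hv _).sub (hv _)) (hc _) (hc _)) <| and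
    (all <| imp (le (hc _) ((hv _).sub (hv _))) <| imp (lt ((hv _).sub (hv _)) (hB.comp _)) <|
      ex <| and (isBeta ((hv _).sub (hv _)) ((hv _).sub (hv _)) ((hv _).sub (hv _))
        ((hv _).sub (hv _))) (isBeta ((hv _).sub (hv _)) ((hv _).sub (hv _))
        (((hv _).sub (hv _)).add (hc _)) ((hA.comp _).mul ((hv _).sub (hv _)))))
    (isBeta ((hv _).sub (hv _)) ((hv _).sub (hv _)) (hB.comp _) (hR.comp _))

end IsArithmetical

/-- The induction principle of a model of Peano Arithmetic. -/
theorem IsPeanoRing.induction (hM : IsPeanoRing M) {P : M → Prop}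
    (hP : IsArithmetical fun v : Fin 1 → NonnegPart M => P (v 0)) (h0 : P 0)
    (hs : ∀ x, 0 ≤ x → P x → P (x + 1)) (x : M) (hx : 0 ≤ x) : P x := by
  classical
  obtain ⟨φ, hφ⟩ := hP
  -- A formula mentions finitely many parameters, which become the variables `a₁, …, aₙ` of the
  -- scheme. The enumeration may include the induction variable too; its slot in `c` gets the dummy
  -- value `0`, and `f` never refers to it.
  let e := φ.freeVarFinset.equivFin
  let c : Fin φ.freeVarFinset.card → NonnegPart M :=
    fun i => Sum.elim id (fun _ => 0) (e.symm i : NonnegPart M ⊕ Fin 1)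
  let f : φ.freeVarFinset → Fin φ.freeVarFinset.card ⊕ Fin 1 :=
    fun a => Sum.elim (fun _ => Sum.inl (e a)) Sum.inr (a : NonnegPart M ⊕ Fin 1)
  let ψ : arith.Formula (Fin φ.freeVarFinset.card ⊕ Fin 1) :=
    BoundedFormula.restrictFreeVar φ f
  have hψ (y : NonnegPart M) (v : Fin φ.freeVarFinset.card ⊕ Fin 1 → NonnegPart M)
      (hv : ∀ i, v (Sum.inl i) = c i) (hy : v (Sum.inr 0) = y) : ψ.Realize v ↔ P y := by
    rw [← hy]
    refine Iff.trans (BoundedFormula.realize_restrictFreeVar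
      (Sum.elim id fun j => v (Sum.inr j)) ?_) (hφ fun j => v (Sum.inr j))
    rintro ⟨a | a, ha⟩
    · simp [f, hv, c]
    · simp [f]
  have key : NonnegPart M ⊨ arith.induction _ ψ :=
    hM.realize_of_mem _ (Or.inr ⟨_, ψ, rfl⟩)
  simp only [Sentence.Realize, arith.induction, Formula.realize_iAlls, Formula.realize_relabel,
    Formula.realize_imp] at key
  refine (hψ ⟨x, hx⟩ _ (fun _ => rfl) rfl).1 (key c (BoundedFormula.realize_subst.2
    ((hψ 0 (fun a => Term.realize c (Sum.elim (fun i => Term.var i) (fun _ => arith.tZero) a))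
      (fun _ => rfl) (arith.realize_tZero _)).2 h0))
    (fun i hi => BoundedFormula.realize_subst.2 ?_) fun _ => ⟨x, hx⟩)
  exact (hψ (i 0 + 1) _ (fun _ => rfl)
    ((arith.realize_tAdd _ _ _).trans (congrArg _ (arith.realize_tOne _)))).2
    (hs _ (i 0).2 ((hψ (i 0) _ (fun _ => rfl) rfl).1 hi))

end Arithmetical

/-! ### Division, Chinese remainders and beta coding in a model of PA. -/

section PeanoArithmetic

theorem IsRem.congr {M : Type u} [CommRing M] [LinearOrder M] {a a' m r : M} (h : IsRem a m r) (ha : m ∣ a' - a) : IsRem a' m r :=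
  ⟨h.1, h.2.1, by simpa using dvd_add ha h.2.2⟩

variable {M : Type u} [CommRing M] [LinearOrder M] [IsStrictOrderedRing M]

theorem IsRem.unique {a m r r' : M} (hd : ∀ x : M, 0 < x → 1 ≤ x) (h : IsRem a m r)
    (h' : IsRem a m r') : r = r' := by
  obtain ⟨h0, hr, t, ht⟩ := h
  obtain ⟨h0', hr', t', ht'⟩ := h'
  have hm : 0 < m := h0.trans_lt hr
  have e : r' - r = m * (t - t') := by linear_combination ht - ht'
  rcases lt_trichotomy t t' with h | h | h
  · have := hd _ (sub_pos.2 h)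
    nlinarith
  · rw [h, sub_self, mul_zero, sub_eq_zero] at e
    exact e.symm
  · have := hd _ (sub_pos.2 h)
    nlinarith

namespace IsPeanoRing


theorem one_le_of_pos (hM : IsPeanoRing M) {x : M} (hx : 0 < x) : 1 ≤ x := by
  have h := hM.induction (P := fun x => x = 0 ∨ 1 ≤ x)
    ((IsArithmetical.eq (.var 0) (.const 0)).or (.le (.const 1) (.var 0))) (Or.inl rfl)
    (fun x hx _ => Or.inr (by linarith)) x hx.le
  exact h.resolve_left hx.ne'

theorem add_one_le (hM : IsPeanoRing M) {x y : M} (h : x < y) : x + 1 ≤ y := by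
  linarith [hM.one_le_of_pos (sub_pos.2 h)]

theorem exists_isRem (hM : IsPeanoRing M) (a : M) {m : M} (hm : 0 < m) : ∃ r, IsRem a m r := by
  have key := hM.induction (P := fun a => ∃ r, IsRem a m r) ?_ ⟨0, le_rfl, hm, by simp⟩ ?_
  · rcases le_total 0 a with ha | ha
    · exact key a ha
    -- For negative `a`, adding the multiple `-a * m` of `m` gives a non-negative element, because
    -- `1 ≤ m`.
    · obtain ⟨r, hr⟩ := key (a + -a * m) (by nlinarith [hM.one_le_of_pos hm])
      exact ⟨r, hr.congr ⟨a, by ring⟩⟩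
  · have hr := (IsPolynomialFun.var (M := M) (Sum.inr 0 : Fin 1 ⊕ Fin 2)).sub (.var (Sum.inr 1))
    exact .ex ((IsArithmetical.le (.const 0) hr).and
      ((IsArithmetical.lt hr (.const m)).and (.dvd (.const m) (.sub (.var _) hr))))
  · rintro x - ⟨r, h0, h1, h2⟩
    rcases (hM.add_one_le h1).lt_or_eq with h | h
    · exact ⟨r + 1, by linarith, h, by simpa using h2⟩
    · refine ⟨0, le_rfl, hm, ?_⟩
      have := dvd_add h2 (dvd_refl m)
      rw [← h] at this ⊢
      convert this using 1
      ring

/-- There are positive elements divisible by all of `1, …, n`. -/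
theorem exists_common_multiple (hM : IsPeanoRing M) {n : M} (hn : 0 ≤ n) :
    ∃ b, 0 < b ∧ ∀ j, 0 < j → j ≤ n → j ∣ b := by
  refine hM.induction (P := fun n => ∃ b, 0 < b ∧ ∀ j, 0 < j → j ≤ n → j ∣ b) ?_ ?_ ?_ n hn
  · have hv {β : Type} (b : β) := IsPolynomialFun.var (M := M) b
    exact .ex (.and (.lt (.const 0) (.sub (hv _) (hv _))) (.all (.imp
      (.lt (.const 0) (.sub (hv _) (hv _))) (.imp (.le (.sub (hv _) (hv _)) (hv _))
      (.dvd (.sub (hv _) (hv _)) (.sub (hv _) (hv _)))))))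
  · exact ⟨1, one_pos, fun j h h' => absurd h' h.not_ge⟩
  · rintro n hn ⟨b, hb, h⟩
    refine ⟨b * (n + 1), by positivity, fun j hj hjn => ?_⟩
    rcases hjn.lt_or_eq with h' | rfl
    · exact (h j hj (by linarith [hM.add_one_le h'])).mul_right _
    · exact dvd_mul_left _ _

theorem exists_chinese_remainder (hM : IsPeanoRing M) {c m : M} (h : IsCoprime c m) (hc : 0 < c)
    (hm : 0 < m) (x y : M) : ∃ a, 0 ≤ a ∧ c ∣ a - x ∧ m ∣ a - y := by
  obtain ⟨u, v, huv⟩ := h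
  -- The usual Bézout solution, reduced modulo `c * m` to make it non-negative.
  obtain ⟨a, ha, -, t, ht⟩ := hM.exists_isRem (x + c * u * (y - x)) (mul_pos hc hm)
  refine ⟨a, ha, ⟨u * (y - x) - m * t, by linear_combination -ht⟩,
    ⟨v * (x - y) - c * t, by linear_combination -ht + (y - x) * huv⟩⟩

/-- The two moduli differ by `(j - i) * b`; each is coprime to `b`, hence also to the divisor `j -
i` of `b`. -/
theorem isCoprime_beta_moduli {b k i j : M}
    (hb : ∀ j, 0 < j → j ≤ k → j ∣ b) (hi : 0 ≤ i) (hij : i < j) (hj : j ≤ k) :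
    IsCoprime (1 + (i + 1) * b) (1 + (j + 1) * b) := by
  have h : IsCoprime (1 + (i + 1) * b) b := ⟨1, -(i + 1), by ring⟩
  have h' := h.mul_right (h.of_isCoprime_of_dvd_right (hb _ (sub_pos.2 hij) (by linarith)))
  have := h'.add_mul_left_right 1
  convert this using 1
  ring

/-- Every sequence coded by Gödel's beta function can be extended by one element. -/
theorem exists_beta_extension (hM : IsPeanoRing M) {a b k x : M} (ha : 0 ≤ a) (hb : 0 ≤ b)
    (hk : 0 ≤ k) (hx : 0 ≤ x) :
    ∃ a' b', 0 ≤ a' ∧ 0 ≤ b' ∧ (∀ i, 0 ≤ i → i < k → ∀ r, IsBeta a b i r → IsBeta a' b' i r) ∧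
      IsBeta a' b' k x := by
  obtain ⟨d, hd, hdvd⟩ := hM.exists_common_multiple hk
  -- The factor `d` makes the new moduli pairwise coprime; the factor `a + x + 1` makes them exceed
  -- every old entry (at most `a`, by `hra`) and the new entry `x`.
  set b' := d * (a + x + 1) with hb'
  have hd1 := hM.one_le_of_pos hd
  have hab : a + x + 1 ≤ b' := by nlinarith
  have hdvd' j (h : 0 < j) (h' : j ≤ k) : j ∣ b' := (hdvd j h h').mul_right _
  have hmod i (hi : 0 ≤ i) : b' < 1 + (i + 1) * b' := by nlinarith
  have hpos i (hi : 0 ≤ i) : 0 < 1 + (i + 1) * b' := by linarith [hmod i hi]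
  have hra i r (hi : 0 ≤ i) (h : IsBeta a b i r) : r ≤ a := by
    obtain ⟨h0, h1, t, ht⟩ := h
    by_contra! hlt
    have : t < 0 := by
      by_contra! h
      nlinarith [mul_nonneg (h0.trans h1.le) h]
    nlinarith [hM.add_one_le this]
  -- The old entries are recoded one at a time. The witness `c` plays the role of the product of the
  -- moduli already treated, described only by divisibility and coprimality so that the predicate
  -- stays arithmetical.
  have key := hM.induction (P := fun n => n ≤ k → ∃ a' c, 0 < c ∧
    (∀ i, 0 ≤ i → i < n → ∀ r, IsBeta a b i r → IsBeta a' b' i r) ∧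
    (∀ i, 0 ≤ i → i < n → 1 + (i + 1) * b' ∣ c) ∧
    (∀ j, n ≤ j → j ≤ k → IsCoprime c (1 + (j + 1) * b'))) ?_ ?_ ?_ k hk le_rfl
  · obtain ⟨a', c, hc, h1, h2, h3⟩ := key
    obtain ⟨a'', h0, h4, h5⟩ :=
      hM.exists_chinese_remainder (h3 k le_rfl le_rfl) hc (hpos k hk) a' x
    exact ⟨a'', b', h0, by linarith, fun i hi hik r hr =>
      (h1 i hi hik r hr).congr ((h2 i hi hik).trans h4), hx, by linarith [hmod k hk], h5⟩
  · have hv {β : Type} (b : β) := IsPolynomialFun.var (M := M) b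
    have hc {β : Type} (b : M) := IsPolynomialFun.const (M := M) (α := β) b
    have hs {β : Type} (b c : β) := (hv b).sub (hv c)
    exact .imp (.le (hv _) (hc _)) <| .ex <| .ex <| .and (.lt (hc _) (hs _ _)) <| .and
      (.all <| .imp (.le (hc _) (hs _ _)) <| .imp (.lt (hs _ _) (hv _)) <| .all <|
        .imp (.isBeta (hc _) (hc _) (hs _ _) (hs _ _)) (.isBeta (hs _ _) (hc _) (hs _ _) (hs _ _)))
      <| .and (.all <| .imp (.le (hc _) (hs _ _)) <| .imp (.lt (hs _ _) (hv _)) <|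
        .dvd (.add (hc _) (.mul (.add (hs _ _) (hc _)) (hc _))) (hs _ _))
      (.all <| .imp (.le (hv _) (hs _ _)) <| .imp (.le (hs _ _) (hc _)) <|
        .isCoprime (hs _ _) (.add (hc _) (.mul (.add (hs _ _) (hc _)) (hc _))))
  · exact fun _ => ⟨0, 1, one_pos, fun i h h' => absurd h' h.not_gt,
      fun i h h' => absurd h' h.not_gt, fun _ _ _ => isCoprime_one_left⟩
  · intro n hn ih hnk
    obtain ⟨a', c, hc, h1, h2, h3⟩ := ih (by linarith)
    have hm : 0 < 1 + (n + 1) * b := by positivity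
    obtain ⟨y, hy⟩ := hM.exists_isRem a hm
    obtain ⟨a'', h0, h4, h5⟩ :=
      hM.exists_chinese_remainder (h3 n le_rfl (by linarith)) hc (hpos n hn) a' y
    have hlt i (hi : i < n + 1) : i < n ∨ i = n := by
      rcases lt_trichotomy i n with h | h | h
      · exact Or.inl h
      · exact Or.inr h
      · linarith [hM.add_one_le h]
    refine ⟨a'', c * (1 + (n + 1) * b'), mul_pos hc (hpos n hn), fun i hi hin r hr => ?_,
      fun i hi hin => ?_, fun j hj hjk => ?_⟩
    · rcases hlt i hin with h | rfl
      · exact (h1 i hi h r hr).congr ((h2 i hi h).trans h4)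
      · obtain rfl := hr.unique (fun x => hM.one_le_of_pos) hy
        exact ⟨hr.1, by linarith [hmod i hi, hra i r hi hr], h5⟩
    · rcases hlt i hin with h | rfl
      · exact (h2 i hi h).mul_right _
      · exact dvd_mul_left _ _
    · exact (h3 j (by linarith) hjk).mul_left
        (isCoprime_beta_moduli hdvd' hn (by linarith) hjk)

/-! ### The exponential function -/

theorem isPow_zero (p : M) : IsPow p 0 1 :=
  ⟨1, 1, zero_le_one, zero_le_one, ⟨zero_le_one, by norm_num, by simp⟩,
    fun _ h h' => absurd h' h.not_gt, ⟨zero_le_one, by norm_num, by simp⟩⟩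

theorem isPow_zero_iff (hM : IsPeanoRing M) {p q : M} : IsPow p 0 q ↔ q = 1 := by
  refine ⟨?_, fun h => h ▸ isPow_zero p⟩
  rintro ⟨a, b, -, -, h, -, h'⟩
  exact h'.unique (fun x => hM.one_le_of_pos) h

/-- A code of the longer sequence also codes its truncation; conversely, beta extension appends the
entry `p * r`. -/
theorem isPow_add_one_iff (hM : IsPeanoRing M) {p k q : M} (hp : 0 ≤ p) (hk : 0 ≤ k) :
    IsPow p (k + 1) q ↔ ∃ r, IsPow p k r ∧ q = p * r := by
  constructor
  · rintro ⟨a, b, ha, hb, h0, hs, hq⟩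
    obtain ⟨r, hr, hpr⟩ := hs k hk (lt_add_one k)
    exact ⟨r, ⟨a, b, ha, hb, h0, fun i hi hik => hs i hi (hik.trans (lt_add_one k)), hr⟩,
      hq.unique (fun x => hM.one_le_of_pos) hpr⟩
  · rintro ⟨r, ⟨a, b, ha, hb, h0, hs, hr⟩, rfl⟩
    obtain ⟨a', b', ha', hb', h, hx⟩ :=
      hM.exists_beta_extension ha hb (by linarith : 0 ≤ k + 1) (mul_nonneg hp hr.1)
    refine ⟨a', b', ha', hb', h 0 le_rfl (by linarith) 1 h0, fun i hi hik => ?_, hx⟩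
    rcases (hM.add_one_le hik).lt_or_eq with h' | h'
    · obtain ⟨s, hs, hs'⟩ := hs i hi (by linarith)
      exact ⟨s, h i hi hik s hs, h (i + 1) (by linarith) h' _ hs'⟩
    · obtain rfl : i = k := add_right_cancel h'
      exact ⟨r, h i hi hik r hr, hx⟩

theorem exists_isPow (hM : IsPeanoRing M) {p k : M} (hp : 0 ≤ p) (hk : 0 ≤ k) :
    ∃ q, IsPow p k q :=
  hM.induction (P := fun k => ∃ q, IsPow p k q)
    (.ex (.isPow (.const _) (.var _) (.sub (.var _) (.var _)))) ⟨1, isPow_zero p⟩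
    (fun _ hk ⟨q, hq⟩ => ⟨p * q, (hM.isPow_add_one_iff hp hk).2 ⟨q, hq, rfl⟩⟩) k hk

theorem isPow_unique (hM : IsPeanoRing M) {p k : M} (hp : 0 ≤ p) (hk : 0 ≤ k) :
    ∀ q q', IsPow p k q → IsPow p k q' → q = q' := by
  refine hM.induction (P := fun k => ∀ q q', IsPow p k q → IsPow p k q' → q = q') ?_ ?_ ?_ k hk
  · have hs {β : Type} (b c : β) := (IsPolynomialFun.var (M := M) b).sub (.var c)
    exact .all <| .all <| .imp (.isPow (.const _) (.var _) (hs _ _)) <|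
      .imp (.isPow (.const _) (.var _) (hs _ _)) (.eq (hs _ _) (hs _ _))
  · intro q q' h h'
    rw [hM.isPow_zero_iff.1 h, hM.isPow_zero_iff.1 h']
  · intro k hk ih q q' h h'
    obtain ⟨r, hr, rfl⟩ := (hM.isPow_add_one_iff hp hk).1 h
    obtain ⟨r', hr', rfl⟩ := (hM.isPow_add_one_iff hp hk).1 h'
    rw [ih r r' hr hr']

end IsPeanoRing

end PeanoArithmetic

/-! ### Powers of `p` and Hensel's lemma inside the model. -/

section Exponential

variable {M : Type u} [CommRing M] [LinearOrder M] [IsStrictOrderedRing M]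

/-- `E` is the exponential function with base `p` on non-negative arguments. -/
def IsExponential (p : M) (E : M → M) : Prop :=
  ∀ k q, 0 ≤ k → (IsPow p k q ↔ q = E k)

theorem IsPeanoRing.exists_isExponential (hM : IsPeanoRing M) {p : M} (hp : 0 ≤ p) :
    ∃ E, IsExponential p E := by
  choose! E hE using fun k (hk : 0 ≤ k) => hM.exists_isPow hp hk
  exact ⟨E, fun k q hk => ⟨fun h => hM.isPow_unique hp hk _ _ h (hE k hk), fun h => h ▸ hE k hk⟩⟩

/-- The function `E` is not given by a term, but its graph is definable, so its value can be
replaced by a quantified variable. This permits the later inductions on statements involving `E`. -/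
theorem IsArithmetical.exponential {α : Type} {p : M} {E : M → M} (hE : IsExponential p E)
    {K : (α → NonnegPart M) → M} (hK : IsPolynomialFun K) (hK0 : ∀ v, 0 ≤ K v)
    {P : (α → NonnegPart M) → M → Prop}
    (hP : IsArithmetical fun w : α ⊕ Fin 2 → NonnegPart M =>
      P (fun a => w (Sum.inl a)) (w (Sum.inr 0) - w (Sum.inr 1))) :
    IsArithmetical fun v => P v (E (K v)) :=
  (ex (P := fun v q => IsPow p (K v) q ∧ P v q)
    (.and (.isPow (.const _) (hK.comp _) (.sub (.var _) (.var _))) hP)).congr fun v =>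
    ⟨fun h => ⟨_, (hE _ _ (hK0 v)).2 rfl, h⟩, fun ⟨_, h, h'⟩ => (hE _ _ (hK0 v)).1 h ▸ h'⟩

theorem IsPeanoRing.two_le_prime (hM : IsPeanoRing M) {p : M} (hp0 : 0 < p) (hp : Prime p) :
    2 ≤ p := by
  have h1 : 1 < p := lt_of_le_of_ne (hM.one_le_of_pos hp0) fun h => hp.not_isUnit (h ▸ isUnit_one)
  linarith [hM.add_one_le h1]

theorem IsPeanoRing.isCoprime_prime (hM : IsPeanoRing M) {p : M} (hp0 : 0 < p) (hp : Prime p)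
    {u : M} (hu : ¬ p ∣ u) : IsCoprime u p := by
  have key := hM.induction (P := fun n => ∀ x, 0 < x → x ≤ n → x < p → IsCoprime x p) ?_
    (fun x hx hx' => absurd hx' hx.not_ge) ?_
  · obtain ⟨r, h0, h1, t, ht⟩ := hM.exists_isRem u hp0
    have hr : 0 < r := h0.lt_of_ne (by rintro rfl; exact hu ⟨t, by linear_combination ht⟩)
    obtain rfl : u = r + p * t := by linear_combination ht
    exact (key r h0 r hr le_rfl h1).add_mul_left_left t
  · have hs {β : Type} (b c : β) := (IsPolynomialFun.var (M := M) b).sub (.var c)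
    exact .all <| .imp (.lt (.const _) (hs _ _)) <| .imp (.le (hs _ _) (.var _)) <|
      .imp (.lt (hs _ _) (.const _)) <| .isCoprime (hs _ _) (.const _)
  · intro n hn ih x hx hxn hxp
    -- Divide `p` by `x`. If the remainder is `0`, then `p = x * t`, and primality with `x < p`
    -- makes `x` a unit. Otherwise the remainder is smaller than `x`, and its Bézout relation with
    -- `p` gives one for `x`.
    obtain ⟨r, h0, h1, t, ht⟩ := hM.exists_isRem p hx
    rcases h0.eq_or_lt with rfl | hr
    · rw [sub_zero] at ht
      rcases hp.dvd_or_dvd (ht ▸ dvd_rfl : p ∣ x * t) with ⟨s, hs⟩ | ⟨s, hs⟩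
      · have : 0 < s := by
          by_contra! h
          nlinarith
        nlinarith [hM.one_le_of_pos this]
      · exact ⟨s, 0, mul_left_cancel₀ hp0.ne' (by rw [hs] at ht; linear_combination -ht)⟩
    · have h := ih r hr (by linarith [hM.add_one_le h1]) (h1.trans hxp)
      obtain ⟨a, b, hab⟩ := h
      exact ⟨-(a * t), a + b, by linear_combination hab + a * ht⟩

namespace IsExponential

variable {p : M} {E : M → M} (hE : IsExponential p E)

theorem zero (hE : IsExponential p E) : E 0 = 1 :=
  ((hE 0 1 le_rfl).1 (IsPeanoRing.isPow_zero p)).symm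

variable (hM : IsPeanoRing M) (hp0 : 0 < p)
include hE hM hp0

theorem add_one {k : M} (hk : 0 ≤ k) : E (k + 1) = p * E k :=
  ((hE _ _ (by linarith)).1
    ((hM.isPow_add_one_iff hp0.le hk).2 ⟨E k, (hE _ _ hk).2 rfl, rfl⟩)).symm

theorem one : E 1 = p := by
  rw [← zero_add 1, hE.add_one hM hp0 le_rfl, hE.zero, mul_one]

theorem add {m n : M} (hm : 0 ≤ m) (hn : 0 ≤ n) : E (m + n) = E m * E n := by
  refine hM.induction (P := fun n => E (m + n) = E m * E n) ?_ ?_ (fun n hn ih => ?_) n hn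
  · have hs {β : Type} (b c : β) := (IsPolynomialFun.var (M := M) b).sub (.var c)
    refine .exponential hE (P := fun v q => q = E m * E (v 0)) (.add (.const _) (.var _))
      (fun v => add_nonneg hm (v 0).2) ?_
    refine .exponential hE (P := fun w q => (w (Sum.inr 0) : M) - w (Sum.inr 1) = E m * q) (.var _)
      (fun v => (v _).2) ?_
    exact .eq (hs _ _) (.mul (.const _) (hs _ _))
  · rw [add_zero, hE.zero, mul_one]
  · rw [← add_assoc, hE.add_one hM hp0 (add_nonneg hm hn), ih, hE.add_one hM hp0 hn]
    ring

theorem dvd_of_le {m n : M} (hm : 0 ≤ m) (h : m ≤ n) : E m ∣ E n :=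
  ⟨E (n - m), by rw [← hE.add hM hp0 hm (sub_nonneg.2 h), add_sub_cancel]⟩

variable (hp : Prime p)
include hp

theorem lt_self {n : M} (hn : 0 ≤ n) : n < E n := by
  refine hM.induction (P := fun n => n < E n) ?_ ?_ (fun n hn ih => ?_) n hn
  · exact .exponential hE (P := fun v q => (v 0 : M) < q) (.var _)
      (fun v => (v _).2) (.lt (.var _) (.sub (.var _) (.var _)))
  · rw [hE.zero]; exact one_pos
  · rw [hE.add_one hM hp0 hn]
    nlinarith [hM.two_le_prime hp0 hp, hM.add_one_le ih]

theorem pos {n : M} (hn : 0 ≤ n) : 0 < E n := hn.trans_lt (hE.lt_self hM hp0 hp hn)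

theorem le_of_dvd {m n : M} (hn : 0 ≤ n) (h : E m ∣ E n) : m ≤ n := by
  by_contra! hlt
  obtain ⟨t, ht⟩ := (hE.dvd_of_le hM hp0 (by linarith : 0 ≤ n + 1) (hM.add_one_le hlt)).trans h
  rw [hE.add_one hM hp0 hn] at ht
  exact hp.not_dvd_one ⟨t, mul_left_cancel₀ (hE.pos hM hp0 hp hn).ne' (by linear_combination ht)⟩

/-- Only `0` is divisible by all powers of `p`. -/
theorem eq_zero_of_forall_dvd {x : M} (h : ∀ n, 0 ≤ n → E n ∣ x) : x = 0 := by
  by_contra hx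
  have hE0 := hE.lt_self hM hp0 hp (abs_nonneg x)
  obtain ⟨t, ht⟩ := h _ (abs_nonneg x)
  have h1 : 1 ≤ |t| := hM.one_le_of_pos (abs_pos.2 fun h => hx (by rw [ht, h, mul_zero]))
  have := congrArg abs ht
  rw [abs_mul, abs_of_pos (hE.pos hM hp0 hp (abs_nonneg x))] at this
  nlinarith [abs_nonneg x]

/-- If no largest power existed, every cofactor of a power dividing `x` would again be divisible by
`p`; induction would make all powers divide `x`. -/
theorem exists_eq_mul {x : M} (hx : x ≠ 0) : ∃ n u, 0 ≤ n ∧ x = E n * u ∧ ¬ p ∣ u := by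
  by_contra! h
  refine hx (hE.eq_zero_of_forall_dvd hM hp0 hp (hM.induction ?_ ?_ ?_))
  · exact .exponential hE (P := fun _ q => q ∣ x) (.var _)
      (fun v => (v _).2) (.dvd (.sub (.var _) (.var _)) (.const _))
  · rw [hE.zero]; exact one_dvd x
  · rintro n hn ⟨u, hu⟩
    obtain ⟨v, rfl⟩ := h n u hn hu
    exact ⟨v, by rw [hu, hE.add_one hM hp0 hn]; ring⟩

theorem isCoprime {u n : M} (hu : ¬ p ∣ u) (hn : 0 ≤ n) : IsCoprime u (E n) := by
  refine hM.induction (P := fun n => IsCoprime u (E n)) ?_ ?_ (fun n hn ih => ?_) n hn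
  · exact .exponential hE (P := fun _ q => IsCoprime u q) (.var _)
      (fun v => (v _).2) (.isCoprime (.const _) (.sub (.var _) (.var _)))
  · rw [hE.zero]; exact isCoprime_one_right
  · rw [hE.add_one hM hp0 hn]
    exact (hM.isCoprime_prime hp0 hp hu).mul_right ih

/-- Hensel's lemma modulo every power of `p`. -/
theorem exists_dvd_eval (f : Polynomial M) {a : M} (ha : p ∣ f.eval a)
    (ha' : ¬ p ∣ f.derivative.eval a) {n : M} (hn : 0 ≤ n) :
    ∃ x, p ∣ x - a ∧ E (n + 1) ∣ f.eval x := by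
  refine hM.induction (P := fun n => ∃ x, p ∣ x - a ∧ E (n + 1) ∣ f.eval x) ?_ ?_ ?_ n hn
  · have hs {β : Type} (b c : β) := (IsPolynomialFun.var (M := M) b).sub (.var c)
    exact .exponential hE (P := fun _ q => ∃ x, p ∣ x - a ∧ q ∣ f.eval x)
      (.add (.var _) (.const _)) (fun v => add_nonneg (v _).2 zero_le_one)
      (.ex (.and (.dvd (.const _) (.sub (hs _ _) (.const _))) (.dvd (hs _ _) (.eval f (hs _ _)))))
  · exact ⟨a, by simp, by rwa [zero_add, hE.one hM hp0]⟩
  · rintro n hn ⟨x, hx, t, ht⟩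
    have hx' : ¬ p ∣ f.derivative.eval x := fun h => ha' <| by
      have := dvd_sub h (hx.trans (Polynomial.sub_dvd_eval_sub x a f.derivative))
      rwa [sub_sub_cancel] at this
    obtain ⟨u, v, huv⟩ := hM.isCoprime_prime hp0 hp hx'
    -- Newton step: `u` inverts the derivative modulo `p`, so the linear term cancels `f.eval x = E
    -- (n + 1) * t` up to a factor `p`; the quadratic term contains `E (n + 1) ^ 2`.
    obtain ⟨g, hg⟩ := f.binomExpansion x (-(u * t) * E (n + 1))
    have hEn := hE.add_one hM hp0 hn
    refine ⟨x + -(u * t) * E (n + 1), ?_, ?_⟩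
    · rw [hEn, add_sub_right_comm]
      exact dvd_add hx ⟨-(u * t) * E n, by ring⟩
    · rw [hg, ht, hE.add_one hM hp0 (by linarith : 0 ≤ n + 1)]
      refine ⟨v * t + g * (u * t) ^ 2 * E n, ?_⟩
      rw [hEn]
      linear_combination p * E n * t * -huv

end IsExponential

end Exponential

/-! ### The inverse limit of the rings `M / p^n`. -/

/-- The properties of the powers `e n` of a prime element `p`, with exponents in the non-negative
part of an ordered ring, that make the inverse limit of the residue rings modulo `e n` a Henselian
valuation ring. -/
structure IsPowerSystem {M : Type u} [CommRing M] [LinearOrder M] [IsStrictOrderedRing M]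
    (p : M) (e : NonnegPart M → M) : Prop where
  prime : Prime p
  zero : e 0 = 1
  one : e 1 = p
  add : ∀ m n, e (m + n) = e m * e n
  ne_zero : ∀ n, e n ≠ 0
  le_of_dvd : ∀ m n, e m ∣ e n → m ≤ n
  exists_eq_mul : ∀ x, x ≠ 0 → ∃ n u, x = e n * u ∧ ¬ p ∣ u
  eq_zero : ∀ x, (∀ n, e n ∣ x) → x = 0
  isCoprime : ∀ u, ¬ p ∣ u → ∀ n, IsCoprime u (e n)
  exists_dvd_eval : ∀ (f : Polynomial M) (a : M), p ∣ f.eval a → ¬ p ∣ f.derivative.eval a →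
    ∀ n, ∃ x, p ∣ x - a ∧ e (n + 1) ∣ f.eval x

/-- The inverse limit of the residue rings `M / e n`, for non-negative `n`. -/
def PowerLimit {M : Type u} [CommRing M] [LinearOrder M] [IsStrictOrderedRing M]
    (e : NonnegPart M → M) : Subring (∀ n, M ⧸ Ideal.span {e n}) where
  -- Compatibility is a common lift to `M`, which needs no transition maps and no assumption on `e`.
  carrier := {x | ∀ m n, m ≤ n →
    ∃ a : M, x n = Ideal.Quotient.mk _ a ∧ x m = Ideal.Quotient.mk _ a}
  zero_mem' _ _ _ := ⟨0, by simp⟩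
  one_mem' _ _ _ := ⟨1, by simp⟩
  add_mem' hx hy m n h := by
    obtain ⟨a, ha, ha'⟩ := hx m n h
    obtain ⟨b, hb, hb'⟩ := hy m n h
    exact ⟨a + b, by simp [ha, hb], by simp [ha', hb']⟩
  mul_mem' hx hy m n h := by
    obtain ⟨a, ha, ha'⟩ := hx m n h
    obtain ⟨b, hb, hb'⟩ := hy m n h
    exact ⟨a * b, by simp [ha, hb], by simp [ha', hb']⟩
  neg_mem' hx m n h := by
    obtain ⟨a, ha, ha'⟩ := hx m n h
    exact ⟨-a, by simp [ha], by simp [ha']⟩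

namespace PowerLimit

variable {M : Type u} [CommRing M] [LinearOrder M] [IsStrictOrderedRing M]

/-- The canonical map from `M` to the inverse limit. -/
def of (e : NonnegPart M → M) : M →+* PowerLimit e :=
  (RingHom.pi fun n => Ideal.Quotient.mk (Ideal.span {e n})).codRestrict (PowerLimit e)
    fun a _ _ _ => ⟨a, rfl, rfl⟩

/-- The projection from the inverse limit to `M / e n`. -/
def proj (e : NonnegPart M → M) (n : NonnegPart M) : PowerLimit e →+* M ⧸ Ideal.span {e n} :=
  (Pi.evalRingHom _ n).comp (PowerLimit e).subtype

variable {p : M} {e : NonnegPart M → M}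

theorem proj_of (n : NonnegPart M) (a : M) : proj e n (of e a) = Ideal.Quotient.mk _ a := rfl

theorem ext_proj {x y : PowerLimit e} (h : ∀ n, proj e n x = proj e n y) : x = y :=
  Subtype.ext (funext h)

theorem exists_proj_eq (n : NonnegPart M) (x : PowerLimit e) :
    ∃ a, proj e n x = Ideal.Quotient.mk _ a :=
  let ⟨a, ha⟩ := Ideal.Quotient.mk_surjective (proj e n x)
  ⟨a, ha.symm⟩

theorem proj_surjective (n : NonnegPart M) : Function.Surjective (proj e n) := fun y =>
  let ⟨a, ha⟩ := Ideal.Quotient.mk_surjective y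
  ⟨of e a, ha⟩

theorem mk_eq_zero_iff {n : NonnegPart M} {a : M} :
    Ideal.Quotient.mk (Ideal.span {e n}) a = 0 ↔ e n ∣ a := by
  rw [Ideal.Quotient.eq_zero_iff_mem, Ideal.mem_span_singleton]

theorem mk_eq_mk_iff {n : NonnegPart M} {a b : M} :
    Ideal.Quotient.mk (Ideal.span {e n}) a = Ideal.Quotient.mk _ b ↔ e n ∣ a - b := by
  rw [Ideal.Quotient.eq, Ideal.mem_span_singleton]

/-- Residue classes that are unique modulo each `e n` define an element of the limit. -/
theorem exists_of_unique {Q : NonnegPart M → M → Prop} (hex : ∀ n, ∃ a, Q n a)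
    (hmono : ∀ m n, m ≤ n → ∀ a, Q n a → Q m a) (huniq : ∀ n a b, Q n a → Q n b → e n ∣ a - b) :
    ∃ x : PowerLimit e, ∀ n, ∃ a, Q n a ∧ proj e n x = Ideal.Quotient.mk _ a := by
  choose a ha using hex
  exact ⟨⟨fun n => Ideal.Quotient.mk _ (a n), fun m n h => ⟨a n, rfl,
    mk_eq_mk_iff.2 (huniq m _ _ (ha m) (hmono m n h _ (ha n)))⟩⟩, fun n => ⟨a n, ha n, rfl⟩⟩

variable (he : IsPowerSystem p e)
include he

theorem _root_.IsPowerSystem.dvd_of_le {m n : NonnegPart M} (h : m ≤ n) : e m ∣ e n := by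
  obtain ⟨d, rfl⟩ := exists_add_of_le h
  exact ⟨e d, he.add m d⟩

/-- A congruence modulo `e n` implies the congruence modulo `e m`, for `m ≤ n`. -/
theorem proj_eq_of_le {m n : NonnegPart M} (h : m ≤ n) {x : PowerLimit e} {a : M}
    (hx : proj e n x = Ideal.Quotient.mk _ a) : proj e m x = Ideal.Quotient.mk _ a := by
  obtain ⟨b, hb, hb'⟩ := x.2 m n h
  refine Eq.trans hb' (mk_eq_mk_iff.2 ((he.dvd_of_le h).trans (mk_eq_mk_iff.1 ?_)))
  exact hb.symm.trans hx

/-- Dividing by `e k` loses `k` levels: the quotient modulo `e n` is read off from `x` at level `n +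
k`, where it is unique by cancelling `e k`. -/
theorem exists_eq_of_mul {k : NonnegPart M} {x : PowerLimit e} (hx : proj e k x = 0) :
    ∃ y, x = of e (e k) * y := by
  have key := exists_of_unique (e := e)
    (Q := fun n b => proj e (n + k) x = Ideal.Quotient.mk _ (e k * b)) ?_ ?_ ?_
  · obtain ⟨y, hy⟩ := key
    refine ⟨y, ext_proj fun n => ?_⟩
    obtain ⟨b, hb, hb'⟩ := hy n
    rw [map_mul, hb', proj_of, ← map_mul]
    exact proj_eq_of_le he (le_add_of_nonneg_right k.2) hb
  · intro n
    obtain ⟨a, ha⟩ := exists_proj_eq (n + k) x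
    have := proj_eq_of_le he (le_add_of_nonneg_left n.2 : k ≤ n + k) ha
    rw [hx, eq_comm, mk_eq_zero_iff] at this
    obtain ⟨b, rfl⟩ := this
    exact ⟨b, ha⟩
  · exact fun m n h b hb => proj_eq_of_le he (add_le_add_left h k) hb
  · intro n a b ha hb
    have := mk_eq_mk_iff.1 (ha.symm.trans hb)
    rw [he.add, mul_comm, ← mul_sub] at this
    exact (mul_dvd_mul_iff_left (he.ne_zero k)).1 this

theorem eq_zero_of_of_mul_eq_zero {k : NonnegPart M} {y : PowerLimit e}
    (h : of e (e k) * y = 0) : y = 0 := by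
  refine ext_proj fun n => ?_
  obtain ⟨b, hb⟩ := exists_proj_eq (n + k) y
  have := congrArg (proj e (n + k)) h
  rw [map_mul, hb, proj_of, ← map_mul, map_zero, mk_eq_zero_iff, he.add, mul_comm,
    mul_dvd_mul_iff_left (he.ne_zero k)] at this
  rw [proj_eq_of_le he (le_add_of_nonneg_right k.2) hb, map_zero, mk_eq_zero_iff]
  exact this

theorem of_injective : Function.Injective (of e) := by
  refine (injective_iff_map_eq_zero _).2 fun a ha => he.eq_zero a fun n => ?_
  rw [← mk_eq_zero_iff, ← proj_of, ha, map_zero]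

theorem isUnit_iff {x : PowerLimit e} : IsUnit x ↔ proj e 1 x ≠ 0 := by
  constructor
  · intro h h0
    have := h.map (proj e 1)
    rw [h0, isUnit_zero_iff, eq_comm, ← map_one (Ideal.Quotient.mk _), mk_eq_zero_iff,
      he.one] at this
    exact he.prime.not_dvd_one this
  · intro h
    -- Inverses modulo `e n` come from Bézout and are unique. The level `n + 1` used for existence
    -- lies above `1`, so the representative is known to be prime to `p` even when `n = 0`.
    have key := exists_of_unique (e := e)
      (Q := fun n c => ∃ a, proj e n x = Ideal.Quotient.mk _ a ∧ e n ∣ a * c - 1) ?_ ?_ ?_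
    · obtain ⟨y, hy⟩ := key
      refine IsUnit.of_mul_eq_one y (ext_proj fun n => ?_)
      obtain ⟨b, ⟨a, ha, h⟩, hb⟩ := hy n
      rwa [map_mul, ha, hb, map_one, ← map_mul, ← map_one (Ideal.Quotient.mk _), mk_eq_mk_iff]
    · intro n
      obtain ⟨a, ha⟩ := exists_proj_eq (n + 1) x
      have h1 : ¬ p ∣ a := by
        rwa [proj_eq_of_le he (le_add_of_nonneg_left n.2) ha, Ne, mk_eq_zero_iff, he.one] at h
      obtain ⟨u, v, huv⟩ := he.isCoprime a h1 n
      exact ⟨u, a, proj_eq_of_le he (le_add_of_nonneg_right zero_le_one) ha,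
        -v, by linear_combination huv⟩
    · rintro m n hmn c ⟨a, ha, h⟩
      exact ⟨a, proj_eq_of_le he hmn ha, (he.dvd_of_le hmn).trans h⟩
    · rintro n c d ⟨a, ha, h⟩ ⟨b, hb, h'⟩
      obtain ⟨s, hs⟩ := mk_eq_mk_iff.1 (ha.symm.trans hb)
      obtain ⟨t, ht⟩ := h
      obtain ⟨t', ht'⟩ := h'
      exact ⟨d * t - c * t' - c * d * s, by linear_combination d * ht - c * ht' - c * d * hs⟩

/-- Every nonzero element of the limit is a power of `p` times a unit. -/
theorem exists_eq_mul_unit {x : PowerLimit e} (hx : x ≠ 0) :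
    ∃ n u, IsUnit u ∧ x = of e (e n) * u := by
  obtain ⟨n, hn⟩ : ∃ n, proj e n x ≠ 0 := by
    by_contra! h
    exact hx (ext_proj h)
  -- One level above `n`, so that `j < n` gives `j + 1 ≤ n + 1`: the class of `x` modulo `e (j + 1)`
  -- is then visible in `a`.
  obtain ⟨a, ha⟩ := exists_proj_eq (n + 1) x
  have hn1 : n ≤ n + 1 := le_add_of_nonneg_right zero_le_one
  rw [proj_eq_of_le he hn1 ha, Ne, mk_eq_zero_iff] at hn
  obtain ⟨j, b, rfl, hb⟩ := he.exists_eq_mul a fun h => hn (h ▸ dvd_zero _)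
  have hjn : j < n := lt_of_not_ge fun h => hn ((he.dvd_of_le h).mul_right b)
  obtain ⟨y, rfl⟩ := exists_eq_of_mul he (k := j) <| by
    rw [proj_eq_of_le he (hjn.le.trans hn1) ha, mk_eq_zero_iff]
    exact dvd_mul_right _ _
  refine ⟨j, y, (isUnit_iff he).2 fun h => hb ?_, rfl⟩
  obtain ⟨z, rfl⟩ := exists_eq_of_mul he h
  -- Were the cofactor divisible by `p`, `x` would vanish at level `j + 1`, which forces `p ∣ b`.
  have hj : proj e (j + 1) (of e (e j) * (of e (e 1) * z)) = 0 := by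
    rw [← mul_assoc, ← map_mul, ← he.add, map_mul, proj_of, mk_eq_zero_iff.2 dvd_rfl, zero_mul]
  rw [proj_eq_of_le he (add_le_add_left hjn.le 1) ha, mk_eq_zero_iff, he.add,
    mul_dvd_mul_iff_left (he.ne_zero j), he.one] at hj
  exact hj

theorem isDomain : IsDomain (PowerLimit e) := by
  have : Nontrivial (PowerLimit e) := ⟨0, 1, fun h => by
    have := (isUnit_iff he).1 (isUnit_one (M := PowerLimit e))
    rw [← h, map_zero] at this
    exact this rfl⟩
  have : NoZeroDivisors (PowerLimit e) := ⟨fun {x y} h => by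
    by_contra! hxy
    obtain ⟨n, u, hu, rfl⟩ := exists_eq_mul_unit he hxy.1
    rw [mul_assoc] at h
    exact hxy.2 (hu.mul_right_eq_zero.1 (eq_zero_of_of_mul_eq_zero he h))⟩
  exact NoZeroDivisors.to_isDomain _

theorem valuationRing :
    have := isDomain he
    ValuationRing (PowerLimit e) := by
  have := isDomain he
  refine ValuationRing.iff_dvd_total.2 ⟨fun x y => ?_⟩
  rcases eq_or_ne x 0 with rfl | hx
  · exact Or.inr (dvd_zero y)
  rcases eq_or_ne y 0 with rfl | hy
  · exact Or.inl (dvd_zero x)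
  obtain ⟨m, u, hu, rfl⟩ := exists_eq_mul_unit he hx
  obtain ⟨n, v, hv, rfl⟩ := exists_eq_mul_unit he hy
  rw [hu.mul_right_dvd, hu.dvd_mul_right, hv.mul_right_dvd, hv.dvd_mul_right]
  exact (le_total m n).imp (fun h => map_dvd _ (he.dvd_of_le h))
    fun h => map_dvd _ (he.dvd_of_le h)

theorem charZero : CharZero (PowerLimit e) :=
  charZero_of_injective_ringHom (of_injective he)

theorem ker_proj (k : NonnegPart M) : RingHom.ker (proj e k) = Ideal.span {of e (e k)} := by
  ext x
  rw [RingHom.mem_ker, Ideal.mem_span_singleton]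
  refine ⟨fun h => exists_eq_of_mul he h, ?_⟩
  rintro ⟨y, rfl⟩
  rw [map_mul, proj_of, mk_eq_zero_iff.2 dvd_rfl, zero_mul]

theorem mem_maximalIdeal_iff [IsLocalRing (PowerLimit e)] {x : PowerLimit e} :
    x ∈ IsLocalRing.maximalIdeal (PowerLimit e) ↔ proj e 1 x = 0 := by
  rw [IsLocalRing.mem_maximalIdeal, mem_nonunits_iff, isUnit_iff he, not_not]

omit he in
theorem exists_map_eq (n : NonnegPart M) (f : Polynomial (PowerLimit e)) :
    ∃ g : Polynomial M, g.map (Ideal.Quotient.mk _) = f.map (proj e n) :=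
  Polynomial.map_surjective _ Ideal.Quotient.mk_surjective _

omit he in
theorem proj_eval {n : NonnegPart M} {f : Polynomial (PowerLimit e)} {g : Polynomial M}
    (hg : g.map (Ideal.Quotient.mk _) = f.map (proj e n)) {x : PowerLimit e} {a : M}
    (hx : proj e n x = Ideal.Quotient.mk _ a) :
    proj e n (f.eval x) = Ideal.Quotient.mk _ (g.eval a) := by
  rw [← Polynomial.eval_map_apply, ← Polynomial.eval_map_apply, hg, hx]

theorem henselianLocalRing [IsLocalRing (PowerLimit e)] : HenselianLocalRing (PowerLimit e) where
  is_henselian f _ a₀ h₀ h₁ := by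
    rw [mem_maximalIdeal_iff he] at h₀
    rw [isUnit_iff he] at h₁
    obtain ⟨c, hc⟩ := exists_proj_eq 1 a₀
    have hle (n : NonnegPart M) : 1 ≤ n + 1 := le_add_of_nonneg_left n.2
    have hle' (n : NonnegPart M) : n ≤ n + 1 := le_add_of_nonneg_right zero_le_one
    have lift (n : NonnegPart M) : ∃ g : Polynomial M, ∃ a,
        g.map (Ideal.Quotient.mk _) = f.map (proj e (n + 1)) ∧ p ∣ a - c ∧ p ∣ g.eval a ∧
        ¬ p ∣ g.derivative.eval a := by
      obtain ⟨g, hg⟩ := exists_map_eq (n + 1) f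
      obtain ⟨a, ha⟩ := exists_proj_eq (n + 1) a₀
      have hg' : g.derivative.map (Ideal.Quotient.mk _) = f.derivative.map (proj e (n + 1)) := by
        rw [← Polynomial.derivative_map, hg, Polynomial.derivative_map]
      refine ⟨g, a, hg, ?_, ?_, ?_⟩
      · rw [← he.one, ← mk_eq_mk_iff, ← hc]
        exact (proj_eq_of_le he (hle n) ha).symm
      · rwa [← he.one, ← mk_eq_zero_iff, ← proj_eq_of_le he (hle n) (proj_eval hg ha)]
      · rwa [← he.one, ← mk_eq_zero_iff, ← proj_eq_of_le he (hle n) (proj_eval hg' ha)]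
    -- The condition evaluates `f` itself at `of e b`, so it does not depend on the lift of `f` to
    -- `M`, which varies with the level. Level `n + 1` lies above `1`, so residues modulo `p` can be
    -- controlled.
    have key := exists_of_unique (e := e)
      (Q := fun n b => proj e (n + 1) (f.eval (of e b)) = 0 ∧ p ∣ b - c) ?_ ?_ ?_
    · obtain ⟨x, hx⟩ := key
      refine ⟨x, ext_proj fun n => ?_, ?_⟩
      · obtain ⟨b, ⟨hb, -⟩, hxb⟩ := hx n
        rw [← map_zero (Ideal.Quotient.mk _)] at hb
        obtain ⟨g, hg⟩ := exists_map_eq n f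
        rw [map_zero, proj_eval hg hxb, ← proj_eval (x := of e b) hg (proj_of n b),
          proj_eq_of_le he (hle' n) hb, map_zero]
      · obtain ⟨b, ⟨-, hb⟩, hxb⟩ := hx 1
        rwa [mem_maximalIdeal_iff he, map_sub, hxb, hc, sub_eq_zero, mk_eq_mk_iff, he.one]
    · intro n
      obtain ⟨g, a, hg, hac, ha, ha'⟩ := lift n
      obtain ⟨b, hb, hb'⟩ := he.exists_dvd_eval g a ha ha' n
      refine ⟨b, ?_, by simpa using dvd_add hb hac⟩
      rwa [proj_eval hg (proj_of _ b), mk_eq_zero_iff]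
    · rintro m n hmn b ⟨hb, hb'⟩
      rw [← map_zero (Ideal.Quotient.mk _)] at hb
      exact ⟨(proj_eq_of_le he (add_le_add_left hmn 1) hb).trans (map_zero _), hb'⟩
    · rintro n b d ⟨hb, hbc⟩ ⟨hd, hdc⟩
      obtain ⟨g, a, hg, hac, ha, ha'⟩ := lift n
      rw [proj_eval hg (proj_of _ _), mk_eq_zero_iff] at hb hd
      -- Uniqueness of the root: `g.eval b - g.eval d` is `b - d` times a factor congruent to the
      -- derivative modulo `p`, hence coprime to `e (n + 1)`.
      obtain ⟨k, hk⟩ := g.binomExpansion d (b - d)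
      rw [add_sub_cancel] at hk
      have hbd : p ∣ b - d := by simpa using dvd_sub hbc hdc
      have hda : p ∣ d - a := by simpa using dvd_sub hdc hac
      have hu : ¬ p ∣ g.derivative.eval d + k * (b - d) := fun h => ha' <| by
        have h1 := (dvd_add_left (hbd.mul_left k)).1 h
        have h2 := dvd_sub h1 (hda.trans (Polynomial.sub_dvd_eval_sub d a g.derivative))
        rwa [sub_sub_cancel] at h2
      refine (he.dvd_of_le (hle' n)).trans ((he.isCoprime _ hu (n + 1)).symm.dvd_of_dvd_mul_left ?_)
      have := dvd_sub hb hd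
      rw [hk] at this
      convert this using 1
      ring

end PowerLimit

/-! ### Additive values in a valuation domain. -/

section AddVal

variable {R : Type u} [CommRing R] [IsDomain R] [ValuationRing R]

theorem addVal_le_iff {x y : R} (hx : x ≠ 0) (hy : y ≠ 0) : addVal x hx ≤ addVal y hy ↔ x ∣ y := by
  -- The order dual reverses Mathlib's multiplicative order, which by definition is divisibility by
  -- an element of `R`.
  refine (Units.val_le_val (α := ValuationRing.ValueGroup R (FractionRing R))).symm.trans ?_
  refine Iff.trans (b := ∃ c : R, c • algebraMap R (FractionRing R) x =
    algebraMap R (FractionRing R) y) Iff.rfl (exists_congr fun c => ?_)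
  rw [Algebra.smul_def, ← map_mul, (IsFractionRing.injective R (FractionRing R)).eq_iff, mul_comm,
    eq_comm]

theorem addVal_mul {x y : R} (hx : x ≠ 0) (hy : y ≠ 0) :
    addVal (x * y) (mul_ne_zero hx hy) = addVal x hx + addVal y hy := by
  refine congrArg (fun u => OrderDual.toDual (Additive.ofMul u)) (Units.ext ?_)
  exact (congrArg (ValuationRing.valuation R (FractionRing R)) (map_mul _ x y)).trans
    (map_mul _ _ _)

theorem addVal_one : addVal (1 : R) one_ne_zero = 0 := by
  refine congrArg (fun u => OrderDual.toDual (Additive.ofMul u)) (a₂ := 1) (Units.ext ?_)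
  exact (congrArg (ValuationRing.valuation R (FractionRing R)) (map_one _)).trans (map_one _)

theorem addVal_eq_of_associated {x y : R} (hx : x ≠ 0) (hy : y ≠ 0) (h : Associated x y) :
    addVal x hx = addVal y hy :=
  le_antisymm ((addVal_le_iff hx hy).2 h.dvd) ((addVal_le_iff hy hx).2 h.symm.dvd)

theorem exists_addVal_eq {γ : AddValueGroup R} (hγ : 0 ≤ γ) : ∃ x hx, addVal (x : R) hx = γ := by
  have h : ((Additive.toMul (OrderDual.ofDual γ) : (ValuationRing.ValueGroup R (FractionRing R))ˣ) :
      ValuationRing.ValueGroup R (FractionRing R)) ≤ 1 := hγ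
  obtain ⟨y, hy⟩ : ∃ y, ValuationRing.valuation R (FractionRing R) y =
      Additive.toMul (OrderDual.ofDual γ) := Quotient.exists_rep _
  obtain ⟨x, rfl⟩ := (ValuationRing.mem_integer_iff R (FractionRing R) y).1 (by
    rw [Valuation.mem_integer_iff, hy]; exact h)
  refine ⟨x, ?_, congrArg (fun u => OrderDual.toDual (Additive.ofMul u)) (Units.ext hy)⟩
  rintro rfl
  rw [map_zero, map_zero] at hy
  exact (Units.ne_zero _) hy.symm

end AddVal

theorem segmentIso_of_hom {M : Type u} [CommRing M] [LinearOrder M] [IsStrictOrderedRing M]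
    {Γ : Type u} [AddCommGroup Γ] [LinearOrder Γ] {φ : NonnegPart M →+ Γ}
    (hle : ∀ m n, φ m ≤ φ n ↔ m ≤ n) (hex : ∀ γ, 0 ≤ γ → ∃ n, φ n = γ) (k : NonnegPart M) :
    SegmentIso (k : M) (φ k) := by
  let f (x : Set.Icc (0 : M) k) : Set.Icc 0 (φ k) :=
    ⟨φ ⟨x, x.2.1⟩, by
      rw [← map_zero φ]
      exact ⟨(hle _ _).2 x.2.1, (hle _ _).2 x.2.2⟩⟩
  have hf : StrictMono f := strictMono_of_le_iff_le fun x y =>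
    (hle ⟨x, x.2.1⟩ ⟨y, y.2.1⟩).symm
  have hs : Function.Surjective f := by
    rintro ⟨γ, hγ, hγ'⟩
    obtain ⟨n, rfl⟩ := hex γ hγ
    exact ⟨⟨n, n.2, (hle _ _).1 hγ'⟩, rfl⟩
  refine ⟨hf.orderIsoOfSurjective f hs, fun x y z h => ?_⟩
  have h' : (⟨x, x.2.1⟩ + ⟨y, y.2.1⟩ : NonnegPart M) = ⟨z, z.2.1⟩ := Subtype.ext h
  exact (map_add φ _ _).symm.trans (congrArg φ h')

/-! ### Standard integers in the model, and the power system of `p`. -/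

namespace IsPeanoRing

variable {M : Type u} [CommRing M] [LinearOrder M] [IsStrictOrderedRing M]

theorem exists_natCast_eq (hM : IsPeanoRing M) {x : M} (hx : 0 ≤ x) (n : ℕ) (h : x ≤ n) :
    ∃ m : ℕ, x = m := by
  induction n with
  | zero => exact ⟨0, by rw [Nat.cast_zero] at h ⊢; exact le_antisymm h hx⟩
  | succ n ih =>
    rcases h.lt_or_eq with h | h
    · rw [Nat.cast_add_one] at h
      exact ih (by linarith [hM.add_one_le h])
    · exact ⟨_, h⟩

/-- A divisor of a standard integer is bounded by it, hence standard, so primality of `ℓ` in `ℕ`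
applies. This is the source of unramifiedness. -/
theorem natCast_prime_eq (hM : IsPeanoRing M) {p : M} (hp0 : 0 < p) (hp : Prime p) {ℓ : ℕ}
    (hℓ : ℓ.Prime) (h : p ∣ (ℓ : M)) : (ℓ : M) = p := by
  obtain ⟨c, hc⟩ := h
  have hℓ0 : (0 : M) < ℓ := Nat.cast_pos.2 hℓ.pos
  have hc0 : 0 < c := pos_of_mul_pos_right (hc ▸ hℓ0) hp0.le
  have hc1 := hM.one_le_of_pos hc0
  have hp1 := hM.one_le_of_pos hp0
  obtain ⟨m, rfl⟩ := hM.exists_natCast_eq hp0.le ℓ (by nlinarith)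
  obtain ⟨d, rfl⟩ := hM.exists_natCast_eq hc0.le ℓ (by nlinarith)
  rw [← Nat.cast_mul, Nat.cast_inj] at hc
  rcases (Nat.dvd_prime hℓ).1 (Dvd.intro _ hc.symm) with rfl | rfl
  · exact absurd (Nat.cast_one (R := M) ▸ isUnit_one) hp.not_isUnit
  · rfl

/-- Division by a standard `m` leaves a remainder below `m`, hence a standard one; this yields the
`ℤ`-group property. -/
theorem exists_nsmul_add (hM : IsPeanoRing M) (n : NonnegPart M) {m : ℕ} (hm : 0 < m) :
    ∃ (q : NonnegPart M) (r : ℕ), r < m ∧ n = m • q + r • 1 := by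
  obtain ⟨r, h0, h1, t, ht⟩ := hM.exists_isRem (n : M) (Nat.cast_pos.2 hm : (0 : M) < m)
  obtain ⟨r, rfl⟩ := hM.exists_natCast_eq h0 m h1.le
  have ht0 : 0 ≤ t := by
    by_contra! h
    nlinarith [hM.add_one_le h, n.2]
  refine ⟨⟨t, ht0⟩, r, Nat.cast_lt.1 h1, Subtype.ext ?_⟩
  rw [Nonneg.coe_add, Nonneg.coe_nsmul, Nonneg.coe_nsmul, nsmul_eq_mul, nsmul_eq_mul,
    Nonneg.coe_one]
  linear_combination ht

theorem isPowerSystem (hM : IsPeanoRing M) {p : M} {E : M → M} (hE : IsExponential p E)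
    (hp0 : 0 < p) (hp : Prime p) : IsPowerSystem p fun n : NonnegPart M => E n where
  prime := hp
  zero := hE.zero
  one := hE.one hM hp0
  add m n := hE.add hM hp0 m.2 n.2
  ne_zero n := (hE.pos hM hp0 hp n.2).ne'
  le_of_dvd _ n := hE.le_of_dvd hM hp0 hp n.2
  exists_eq_mul _ hx :=
    let ⟨n, u, hn, h⟩ := hE.exists_eq_mul hM hp0 hp hx
    ⟨⟨n, hn⟩, u, h⟩
  eq_zero _ h := hE.eq_zero_of_forall_dvd hM hp0 hp fun n hn => h ⟨n, hn⟩
  isCoprime _ hu n := hE.isCoprime hM hp0 hp hu n.2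
  exists_dvd_eval f _ h h' n := hE.exists_dvd_eval hM hp0 hp f h h' n.2

end IsPeanoRing

/-! ### The value group of the limit. -/

namespace PowerLimit

variable {M : Type u} [CommRing M] [LinearOrder M] [IsStrictOrderedRing M]
  {p : M} {e : NonnegPart M → M} (he : IsPowerSystem p e)
include he

theorem of_ne_zero (n : NonnegPart M) : of e (e n) ≠ 0 :=
  (map_ne_zero_iff _ (of_injective he)).2 (he.ne_zero n)

variable [IsDomain (PowerLimit e)] [ValuationRing (PowerLimit e)]

/-- The additive values of the elements `e n`. -/
noncomputable def valueHom : NonnegPart M →+ AddValueGroup (PowerLimit e) where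
  toFun n := addVal (of e (e n)) (of_ne_zero he n)
  map_zero' := by
    rw [← addVal_one]
    congr 1
    rw [he.zero, map_one]
  map_add' m n := by
    rw [← addVal_mul]
    congr 1
    rw [he.add, map_mul]

theorem exists_valueHom_eq {γ : AddValueGroup (PowerLimit e)} (hγ : 0 ≤ γ) :
    ∃ n, valueHom he n = γ := by
  obtain ⟨x, hx, rfl⟩ := exists_addVal_eq hγ
  obtain ⟨n, u, hu, rfl⟩ := exists_eq_mul_unit he hx
  exact ⟨n, addVal_eq_of_associated (of_ne_zero he n) hx ⟨hu.unit, rfl⟩⟩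

theorem valueHom_le_iff {m n : NonnegPart M} : valueHom he m ≤ valueHom he n ↔ m ≤ n := by
  refine (addVal_le_iff (of_ne_zero he m) (of_ne_zero he n)).trans
    ⟨fun h => he.le_of_dvd m n ?_, fun h => map_dvd _ (he.dvd_of_le h)⟩
  rwa [← Ideal.mem_span_singleton, ← ker_proj he, RingHom.mem_ker, proj_of, mk_eq_zero_iff] at h

theorem isLeast_valueHom_one :
    IsLeast {γ : AddValueGroup (PowerLimit e) | 0 < γ} (valueHom he 1) := by
  refine ⟨?_, fun γ (hγ : 0 < γ) => ?_⟩
  · rw [Set.mem_ofPred, ← map_zero (valueHom he), lt_iff_not_ge, valueHom_le_iff]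
    exact not_le.2 zero_lt_one
  · obtain ⟨x, hx, rfl⟩ := exists_addVal_eq hγ.le
    refine (addVal_le_iff (of_ne_zero he 1) hx).2 (exists_eq_of_mul he (not_not.1 fun h => ?_))
    refine hγ.not_ge ?_
    rw [← addVal_one, addVal_le_iff]
    exact ((isUnit_iff he).2 h).dvd

theorem isPresburgerGroup (hM : IsPeanoRing M) :
    IsPresburgerGroup (AddValueGroup (PowerLimit e)) := by
  refine ⟨valueHom he 1, isLeast_valueHom_one he, fun n hn x => ?_⟩
  have key (y : AddValueGroup (PowerLimit e)) (hy : 0 ≤ y) :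
      ∃ (z : AddValueGroup (PowerLimit e)) (r : ℕ), r < n ∧ y = n • z + r • valueHom he 1 := by
    obtain ⟨m, rfl⟩ := exists_valueHom_eq he hy
    obtain ⟨q, r, hr, h⟩ := hM.exists_nsmul_add m hn
    exact ⟨valueHom he q, r, hr, by rw [h, map_add, map_nsmul, map_nsmul]⟩
  rcases le_total 0 x with hx | hx
  · exact key x hx
  -- For `x ≤ 0`, the element `(n - 1) • -x` is non-negative and differs from `x` by `n • x`, so it
  -- has the same remainder.
  · obtain ⟨z, r, hr, h⟩ := key ((n - 1) • -x) (nsmul_nonneg (neg_nonneg.2 hx) _)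
    refine ⟨z + x, r, hr, ?_⟩
    obtain ⟨m, rfl⟩ := Nat.exists_eq_add_of_lt hn
    rw [nsmul_add, add_right_comm, ← h]
    simp [add_nsmul]

theorem segmentIso (k : NonnegPart M) : SegmentIso (k : M) (valueHom he k) :=
  segmentIso_of_hom (fun _ _ => valueHom_le_iff he) (fun _ => exists_valueHom_eq he) k

theorem isUnramifiedValuation (hM : IsPeanoRing M) (hp0 : 0 < p) :
    IsUnramifiedValuation (PowerLimit e) := by
  have := ValuationRing.isLocalRing (PowerLimit e)
  intro ℓ hℓ h
  rw [mem_maximalIdeal_iff he, ← map_natCast (of e), proj_of, mk_eq_zero_iff, he.one] at h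
  have h' : (ℓ : PowerLimit e) = of e (e 1) := by
    rw [he.one, ← hM.natCast_prime_eq hp0 he.prime hℓ h, map_natCast]
  have h0 := of_ne_zero he 1
  rw [← h'] at h0
  refine ⟨h0, ?_⟩
  convert isLeast_valueHom_one he using 1
  exact addVal_eq_of_associated _ (of_ne_zero he 1) (h' ▸ Associated.refl _)

end PowerLimit

/-! ### Assembly. -/

theorem mainTheorem9 {M : Type u} [CommRing M] [LinearOrder M] [IsStrictOrderedRing M]
    (hM : IsPeanoRing M) (p : M) (hp0 : 0 < p) (hp : Prime p) (k : M) (hk : 0 < k) :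
    (∃ q : M, IsPow p k q) ∧
    ∀ q : M, IsPow p k q →
      ∃ (_ : IsLocalRing (M ⧸ Ideal.span {q}))
        (R : Type u) (_ : CommRing R) (_ : IsDomain R) (_ : ValuationRing R),
        HenselianLocalRing R ∧ CharZero R ∧ IsUnramifiedValuation R ∧
        IsPresburgerGroup (AddValueGroup R) ∧
        ∃ (α : R) (hα : α ≠ 0),
          SegmentIso k (addVal α hα) ∧
          ∃ (e : (R ⧸ Ideal.span {α}) ≃+* (M ⧸ Ideal.span {q}))
            (g : IsLocalRing.ResidueField R ≃+*
              IsLocalRing.ResidueField (M ⧸ Ideal.span {q})),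
            ∀ x : R, g (IsLocalRing.residue R x) =
              IsLocalRing.residue (M ⧸ Ideal.span {q}) (e (Ideal.Quotient.mk (Ideal.span {α}) x))
      := by
  refine ⟨hM.exists_isPow hp0.le hk.le, fun q hq => ?_⟩
  obtain ⟨E, hE⟩ := hM.exists_isExponential hp0.le
  obtain rfl := (hE k q hk.le).1 hq
  have he := hM.isPowerSystem hE hp0 hp
  set e : NonnegPart M → M := fun n => E n with he_def
  let k' : NonnegPart M := ⟨k, hk.le⟩
  have := PowerLimit.isDomain he
  have := PowerLimit.valuationRing he
  have := ValuationRing.isLocalRing (PowerLimit e)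
  have hnontriv : Nontrivial (M ⧸ Ideal.span {E k}) := by
    refine Ideal.Quotient.nontrivial_iff.2 fun h => ?_
    have h1 : e k' ∣ e 0 := by
      rw [he.zero, ← Ideal.mem_span_singleton, ← Ideal.eq_top_iff_one]
      exact h
    exact hk.not_ge (he.le_of_dvd k' 0 h1)
  have hsurj : Function.Surjective (PowerLimit.proj e k') := PowerLimit.proj_surjective k'
  have hloc : IsLocalRing (M ⧸ Ideal.span {E k}) :=
    IsLocalRing.of_surjective' (PowerLimit.proj e k') hsurj
  let ρ : PowerLimit e →+* IsLocalRing.ResidueField (M ⧸ Ideal.span {E k}) :=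
    (IsLocalRing.residue (M ⧸ Ideal.span {E k})).comp (PowerLimit.proj e k')
  have hρ : Function.Surjective ρ := IsLocalRing.residue_surjective.comp hsurj
  -- The map `ρ` is onto a field, so its kernel is maximal, and a local ring has only one maximal
  -- ideal. The residue field isomorphism is thus induced by the projection, which makes
  -- compatibility definitional.
  have hker : IsLocalRing.maximalIdeal (PowerLimit e) = RingHom.ker ρ :=
    (IsLocalRing.eq_maximalIdeal (RingHom.ker_isMaximal_of_surjective ρ hρ)).symm
  exact ⟨hloc, PowerLimit e, inferInstance, inferInstance, inferInstance,
    PowerLimit.henselianLocalRing he, PowerLimit.charZero he,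
    PowerLimit.isUnramifiedValuation he hM hp0, PowerLimit.isPresburgerGroup he hM,
    PowerLimit.of e (e k'), PowerLimit.of_ne_zero he k', PowerLimit.segmentIso he k',
    (Ideal.quotEquivOfEq (PowerLimit.ker_proj he k').symm).trans
      (RingHom.quotientKerEquivOfSurjective hsurj),
    (Ideal.quotEquivOfEq hker).trans (RingHom.quotientKerEquivOfSurjective hρ), fun x => rfl⟩
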